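/- Write a partition of $[n]=\{1,\dots,n\}$ as its canonical sequence $\pi_1\pi_2\cdots\pi_n$, where $\pi_i=k$ if $i$ lies in the $k$-th block, the blocks being listed in increasing order of their minimum elements. A partition $\pi$ of $[n]$ contains a partition $\sigma$ of $[m]$ (called a pattern) if there are indices $1\le f(1)<\dots<f(m)\le n$ such that for all $i,j\in[m]$, $\pi_{f(i)}<\pi_{f(j)}$ if and only if $\sigma_i<\sigma_j$; otherwise $\pi$ avoids $\sigma$. Let $p(n;\sigma)$ be the number of partitions of $[n]$ that avoid $\sigma$; two patterns $\sigma,\sigma'$ are equivalent if $p(n;\sigma)=p(n;\sigma')$ for every $n$. Theorem. Let $t\ge 0$ be an integer, and let $$\Sigma^+=\{12^{p+1}12^q32^r : p,q,r\ge 0,\ p+q+r=t\},\quad \Sigma^-=\{12^{p+1}32^q12^r : p,q,r\ge 0,\ p+q+r=t\},\quad \Sigma=\Sigma^+\cup\Sigma^-,$$ where $x^d$ denotes $d$ consecutive copies of the symbol $x$ (and an expression such as $12^{p+1}$ means $1$ followed by $p+1$ copies of $2$). Then all the patterns in $\Sigma$ are equivalent: any two patterns $\sigma,\sigma'\in\Sigma$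 satisfy $p(n;\sigma)=p(n;\sigma')$ for every $n\ge 0$. -/

import Mathlib

namespace SetPartition

/-- The canonical sequence of a partition of an `n`-element initial segment: the `i`-th entry is the
index (counted from 1) of the block containing `i`, when the blocks are listed in increasing order
of their minimum elements. -/
def canonicalSeq {n : ℕ} (P : Finpartition (Finset.univ : Finset (Fin n))) (i : Fin n) : ℕ :=
  (P.parts.filter fun B => B.min ≤ (P.part i).min).card

/-- `π` contains `σ`: some subsequence of `π` is order-isomorphic to `σ`. -/
def Contains {n : ℕ} (π : Fin n → ℕ) (σ : List ℕ) : Prop :=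
  ∃ f : Fin σ.length → Fin n, StrictMono f ∧
    ∀ i j : Fin σ.length, π (f i) < π (f j) ↔ σ.get i < σ.get j

/-- The set of partitions of an `n`-element initial segment that avoid the pattern `σ`. -/
def avoiders (n : ℕ) (σ : List ℕ) : Set (Finpartition (Finset.univ : Finset (Fin n))) :=
  {P | ¬ Contains (canonicalSeq P) σ}

/-- Equivalence of patterns: for each `n`, equally many partitions avoid the one and the other. -/
def PatternEquiv (σ τ : List ℕ) : Prop :=
  ∀ n : ℕ, (avoiders n σ).ncard = (avoiders n τ).ncard

/-- The word `1 2^(p+1) 1 2^q 3 2^r`. -/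
def plusWord (p q r : ℕ) : List ℕ :=
  [1] ++ List.replicate (p + 1) 2 ++ [1] ++ List.replicate q 2 ++ [3] ++ List.replicate r 2

/-- The word `1 2^(p+1) 3 2^q 1 2^r`. -/
def minusWord (p q r : ℕ) : List ℕ :=
  [1] ++ List.replicate (p + 1) 2 ++ [3] ++ List.replicate q 2 ++ [1] ++ List.replicate r 2

def sigmaPlus (t : ℕ) : Set (List ℕ) :=
  {σ | ∃ p q r : ℕ, p + q + r = t ∧ σ = plusWord p q r}

def sigmaMinus (t : ℕ) : Set (List ℕ) :=
  {σ | ∃ p q r : ℕ, p + q + r = t ∧ σ = minusWord p q r}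

def sigmaSet (t : ℕ) : Set (List ℕ) :=
  sigmaPlus t ∪ sigmaMinus t

end SetPartition

/-! A canonical sequence is a restricted growth word. Compare each of its letters with a fixed level
`j`, which gives a word in `lt`, `eq`, `gt`. The `2`s of the pattern become `eq`, and the leading
`1` costs nothing: by restricted growth each positive value below `j` occurs before the first `j`.
So avoidance means that no level word contains `eq :: X`, where `X` is `M^p x M^q y M^r` with `M =
eq` and `{x, y} = {lt, gt}` (`contains_patternWord_iff`).

At a single level `m`, cut the word after its first `m` and contract each maximal run of smaller or
of larger letters to one `lt` or `gt`. This gives a reduced skeleton, and reduced subwords see only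
the skeleton. Cut-and-exchange bijections on skeletons, preserving the number of each letter, turn
containment of `X` into containment of any `Y` with `lt` and `gt` interchanged and equally many `eq`
(`triEquiv_triWord`). Refilling the new skeleton with the old runs, in their old order, gives an
injection on restricted growth words (`ncard_hybrid_le`).

The other levels must not notice. Seen from below `m`, all that moves is the length of nonempty runs
of `gt`, and whether a final run exists; a word with no two adjacent `gt` and no final `gt` cannot
detect this (`Fill.sublist_blockWord`). From above the same holds with `lt`. A word whose `lt`
precedes its `gt` is therefore safe above `m`, and one with the opposite order below it. Thus `X`
can be exchanged for `Y` one level at a time, upwards from level 0 (`ncard_levelAvoiders`). -/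

namespace SetPartition

/-! ### Equidistribution over reduced three-letter words -/

/-- No two consecutive `lt` and no two consecutive `gt`. -/
def Reduced (w : List Ordering) : Prop :=
  w.IsChain fun a b => a = b → a = .eq

/-- Equidistribution of two subwords over the reduced words with given letters. -/
def TriEquiv (X Y : List Ordering) : Prop :=
  ∃ φ : {w // Reduced w} ≃ {w // Reduced w},
    ∀ w, (φ w).1.Perm w.1 ∧ (X.Sublist w.1 ↔ Y.Sublist (φ w).1)

theorem TriEquiv.refl (X : List Ordering) : TriEquiv X X :=
  ⟨Equiv.refl _, fun _ => ⟨.refl _, Iff.rfl⟩⟩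

theorem TriEquiv.symm {X Y : List Ordering} (h : TriEquiv X Y) : TriEquiv Y X := by
  obtain ⟨φ, hφ⟩ := h
  refine ⟨φ.symm, fun w => ?_⟩
  have := hφ (φ.symm w)
  rw [φ.apply_symm_apply] at this
  exact ⟨this.1.symm, this.2.symm⟩

theorem TriEquiv.trans {X Y Z : List Ordering} (h : TriEquiv X Y) (h' : TriEquiv Y Z) :
    TriEquiv X Z := by
  obtain ⟨φ, hφ⟩ := h
  obtain ⟨ψ, hψ⟩ := h'
  exact ⟨φ.trans ψ, fun w => ⟨(hψ (φ w)).1.trans (hφ w).1, (hφ w).2.trans (hψ (φ w)).2⟩⟩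

theorem finite_perm {α : Type*} (w : List α) : {v : List α | v.Perm w}.Finite := by
  classical
  refine (w.permutations.toFinset.finite_toSet).subset fun v hv => ?_
  simpa using hv

/-- The words with given letter counts are finitely many, so an injection preserving the counts is a
bijection. A relation lets one description of the cut serve for both totality and injectivity. -/
theorem TriEquiv.of_rel {X Y : List Ordering} (ρ : List Ordering → List Ordering → Prop)
    (total : ∀ w, Reduced w → ∃ w', Reduced w' ∧ ρ w w')
    (inj : ∀ w₁ w₂ w', Reduced w₁ → Reduced w₂ → ρ w₁ w' → ρ w₂ w' → w₁ = w₂)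
    (perm : ∀ w w', ρ w w' → w'.Perm w)
    (sub : ∀ w w', ρ w w' → (X.Sublist w ↔ Y.Sublist w')) : TriEquiv X Y := by
  choose f hf hρ using total
  let F : {w // Reduced w} → {w // Reduced w} := fun w => ⟨f w.1 w.2, hf w.1 w.2⟩
  have hinj : F.Injective := fun a b h => Subtype.ext <|
    inj a.1 b.1 (f a.1 a.2) a.2 b.2 (hρ _ _) (by
      have : f a.1 a.2 = f b.1 b.2 := congrArg Subtype.val h
      rw [this]; exact hρ _ _)
  have hsurj : F.Surjective := by
    intro w
    let S : Set {w // Reduced w} := {v | v.1.Perm w.1}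
    have hS : S.Finite := (finite_perm w.1).preimage Subtype.val_injective.injOn
    have hmaps : Set.MapsTo F S S := fun v hv => (perm _ _ (hρ v.1 v.2)).trans hv
    have := ((hS.injOn_iff_bijOn_of_mapsTo hmaps).1 hinj.injOn).surjOn
    obtain ⟨v, -, hv⟩ := this (show w ∈ S from List.Perm.refl _)
    exact ⟨v, hv⟩
  exact ⟨Equiv.ofBijective F ⟨hinj, hsurj⟩, fun w => ⟨perm _ _ (hρ w.1 w.2), sub _ _ (hρ w.1 w.2)⟩⟩

theorem reduced_map_swap {w : List Ordering} (h : Reduced w) :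
    Reduced (w.map Ordering.swap) := by
  unfold Reduced at *
  rw [List.isChain_map]
  refine h.imp fun a b hab => ?_
  revert hab
  cases a <;> cases b <;> decide

theorem map_swap_swap (w : List Ordering) : (w.map Ordering.swap).map Ordering.swap = w := by
  rw [List.map_map]
  convert List.map_id w using 2
  funext a; cases a <;> rfl

theorem sublist_map_swap {X w : List Ordering} :
    (X.map Ordering.swap).Sublist (w.map Ordering.swap) ↔ X.Sublist w := by
  refine ⟨fun h => ?_, fun h => h.map _⟩
  simpa only [map_swap_swap] using h.map Ordering.swap

theorem TriEquiv.swap {X Y : List Ordering} (h : TriEquiv X Y) :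
    TriEquiv (X.map Ordering.swap) (Y.map Ordering.swap) := by
  obtain ⟨φ, hφ⟩ := h
  let s : {w // Reduced w} ≃ {w // Reduced w} :=
    { toFun := fun w => ⟨w.1.map Ordering.swap, reduced_map_swap w.2⟩
      invFun := fun w => ⟨w.1.map Ordering.swap, reduced_map_swap w.2⟩
      left_inv := fun w => Subtype.ext (map_swap_swap w.1)
      right_inv := fun w => Subtype.ext (map_swap_swap w.1) }
  refine ⟨(s.trans φ).trans s, fun w => ⟨?_, ?_⟩⟩
  · have := (hφ (s w)).1.map Ordering.swap
    change (List.map Ordering.swap (φ (s w)).1).Perm w.1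
    rwa [show List.map Ordering.swap (s w).1 = w.1 from map_swap_swap w.1] at this
  · change _ ↔ (Y.map Ordering.swap).Sublist ((φ (s w)).1.map Ordering.swap)
    rw [sublist_map_swap, ← (hφ (s w)).2, ← sublist_map_swap (X := X)]
    change _ ↔ (X.map Ordering.swap).Sublist ((w.1.map Ordering.swap).map Ordering.swap)
    rw [map_swap_swap]

/-! ### Cutting at a first or last occurrence -/

section Splitting
variable {α : Type*}

theorem append_cons_inj_left {a : α} {u₁ u₂ v₁ v₂ : List α} (h₁ : a ∉ u₁) (h₂ : a ∉ u₂)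
    (h : u₁ ++ a :: v₁ = u₂ ++ a :: v₂) : u₁ = u₂ ∧ v₁ = v₂ := by
  induction u₁ generalizing u₂ with
  | nil =>
    cases u₂ with
    | nil => simpa using h
    | cons c u₂ =>
      simp only [List.nil_append, List.cons_append, List.cons.injEq] at h
      simp [h.1] at h₂
  | cons b u₁ ih =>
    cases u₂ with
    | nil =>
      simp only [List.nil_append, List.cons_append, List.cons.injEq] at h
      simp [h.1] at h₁
    | cons c u₂ =>
      simp only [List.mem_cons, not_or, List.cons_append, List.cons.injEq] at *
      obtain ⟨rfl, rfl⟩ := ih h₁.2 h₂.2 h.2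
      exact ⟨⟨h.1, rfl⟩, rfl⟩

theorem append_cons_inj_right {a : α} {u₁ u₂ v₁ v₂ : List α} (h₁ : a ∉ u₁) (h₂ : a ∉ u₂)
    (h : v₁ ++ a :: u₁ = v₂ ++ a :: u₂) : u₁ = u₂ ∧ v₁ = v₂ := by
  have h' := congrArg List.reverse h
  simp only [List.reverse_append, List.reverse_cons, List.append_assoc, List.cons_append,
    List.nil_append] at h'
  obtain ⟨hu, hv⟩ := append_cons_inj_left (by simpa using h₁) (by simpa using h₂) h'
  exact ⟨List.reverse_injective hu, List.reverse_injective hv⟩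

theorem exists_last_split {a : α} {w : List α} (h : a ∈ w) :
    ∃ v u, a ∉ u ∧ w = v ++ a :: u := by
  obtain ⟨s, t, hst, hs⟩ := List.eq_append_cons_of_mem (List.mem_reverse.2 h)
  refine ⟨t.reverse, s.reverse, by simpa using hs, ?_⟩
  have := congrArg List.reverse hst
  simpa using this

theorem cons_sublist_append_cons {a : α} {u v X : List α} (hu : a ∉ u) :
    (a :: X).Sublist (u ++ a :: v) ↔ X.Sublist v := by
  induction u with
  | nil => simp
  | cons b u ih =>
    simp only [List.mem_cons, not_or] at hu
    rw [List.cons_append, List.cons_sublist_cons', ih hu.2]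
    simp [hu.1]

theorem append_singleton_sublist_append_cons {a : α} {u v X : List α} (hu : a ∉ u) :
    (X ++ [a]).Sublist (v ++ a :: u) ↔ X.Sublist v := by
  rw [← List.reverse_sublist]
  simp only [List.reverse_append, List.reverse_cons, List.append_assoc, List.cons_append,
    List.nil_append, List.reverse_nil]
  rw [cons_sublist_append_cons (by simpa using hu), List.reverse_sublist]

end Splitting

/-! ### Cut-and-exchange bijections -/

theorem reduced_append_eq_cons {u v : List Ordering} :
    Reduced (u ++ .eq :: v) ↔ Reduced u ∧ Reduced v := by
  unfold Reduced
  rw [List.isChain_append, List.isChain_cons]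
  constructor
  · exact fun h => ⟨h.1, h.2.1.2⟩
  · refine fun h => ⟨h.1, ⟨fun y _ => by simp, h.2⟩, fun x _ y hy hxy => ?_⟩
    simp at hy
    rw [hxy, hy]

/-- Exchange the two sides of the first `eq`; it becomes the last `eq`, so the cut can be recovered.
-/
theorem triEquiv_eq_cons (X : List Ordering) : TriEquiv (.eq :: X) (X ++ [.eq]) := by
  refine TriEquiv.of_rel (fun w w' => (.eq ∉ w ∧ w' = w) ∨
    ∃ u v, .eq ∉ u ∧ w = u ++ .eq :: v ∧ w' = v ++ .eq :: u) ?_ ?_ ?_ ?_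
  · intro w hw
    by_cases h : Ordering.eq ∈ w
    · obtain ⟨u, v, rfl, hu⟩ := List.eq_append_cons_of_mem h
      rw [reduced_append_eq_cons] at hw
      exact ⟨_, reduced_append_eq_cons.2 hw.symm, .inr ⟨u, v, hu, rfl, rfl⟩⟩
    · exact ⟨w, hw, .inl ⟨h, rfl⟩⟩
  · rintro w₁ w₂ w' - - (⟨h₁, rfl⟩ | ⟨u₁, v₁, hu₁, rfl, rfl⟩) (⟨h₂, rfl⟩ | ⟨u₂, v₂, hu₂, rfl, h⟩)
    · rfl
    · simp [h] at h₁
    · simp at h₂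
    · obtain ⟨rfl, rfl⟩ := append_cons_inj_right hu₁ hu₂ h
      rfl
  · rintro w w' (⟨-, rfl⟩ | ⟨u, v, -, rfl, rfl⟩)
    · rfl
    · exact List.perm_append_comm.trans (by simpa using List.perm_middle.symm)
  · rintro w w' (⟨h, rfl⟩ | ⟨u, v, hu, rfl, rfl⟩)
    · constructor
      · exact fun hs => absurd (hs.subset (by simp)) h
      · exact fun hs => absurd (hs.subset (by simp)) h
    · rw [cons_sublist_append_cons hu, append_singleton_sublist_append_cons hu]

/-- Apply the given bijection to the part before the last `eq`. -/
theorem TriEquiv.append_eq {X Y : List Ordering} (h : TriEquiv X Y) :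
    TriEquiv (X ++ [.eq]) (Y ++ [.eq]) := by
  obtain ⟨φ, hφ⟩ := h
  refine TriEquiv.of_rel (fun w w' => (.eq ∉ w ∧ w' = w) ∨
    ∃ (v : {w // Reduced w}) (u : List Ordering), .eq ∉ u ∧ w = v.1 ++ .eq :: u ∧
      w' = (φ v).1 ++ .eq :: u) ?_ ?_ ?_ ?_
  · intro w hw
    by_cases h : Ordering.eq ∈ w
    · obtain ⟨v, u, hu, rfl⟩ := exists_last_split h
      rw [reduced_append_eq_cons] at hw
      exact ⟨_, reduced_append_eq_cons.2 ⟨(φ ⟨v, hw.1⟩).2, hw.2⟩, .inr ⟨⟨v, hw.1⟩, u, hu, rfl, rfl⟩⟩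
    · exact ⟨w, hw, .inl ⟨h, rfl⟩⟩
  · rintro w₁ w₂ w' - - (⟨h₁, rfl⟩ | ⟨v₁, u₁, hu₁, rfl, rfl⟩) (⟨h₂, rfl⟩ | ⟨v₂, u₂, hu₂, rfl, h⟩)
    · rfl
    · simp [h] at h₁
    · simp at h₂
    · obtain ⟨rfl, hv⟩ := append_cons_inj_right hu₁ hu₂ h
      rw [φ.injective (Subtype.ext hv)]
  · rintro w w' (⟨-, rfl⟩ | ⟨v, u, -, rfl, rfl⟩)
    · rfl
    · exact (hφ v).1.append_right _
  · rintro w w' (⟨h, rfl⟩ | ⟨v, u, hu, rfl, rfl⟩)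
    · constructor
      · exact fun hs => absurd (hs.subset (by simp)) h
      · exact fun hs => absurd (hs.subset (by simp)) h
    · rw [append_singleton_sublist_append_cons hu, append_singleton_sublist_append_cons hu]
      exact (hφ v).2

theorem reduced_append_lt_cons {u v : List Ordering} :
    Reduced (u ++ .lt :: v) ↔ Reduced (u ++ [.lt]) ∧ Reduced v ∧ v.head? ≠ some .lt := by
  unfold Reduced
  rw [List.isChain_append, List.isChain_append, List.isChain_cons]
  cases v with
  | nil => simp
  | cons a v => cases a <;> simp <;> tauto

theorem reduced_lt_prefix {e R : List Ordering} (he : e = [] ∨ e = [.lt])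
    (hR : R.head? ≠ some .lt) : Reduced (e ++ R) ↔ Reduced R := by
  rcases he with rfl | rfl
  · rfl
  · have := reduced_append_lt_cons (u := []) (v := R)
    simp only [List.nil_append] at this
    rw [List.singleton_append, this]
    exact ⟨fun h => h.2.1, fun h => ⟨by simp [Reduced], h, hR⟩⟩

theorem sublist_lt_prefix {e R Y : List Ordering} (he : e = [] ∨ e = [.lt])
    (hY : Y.head? ≠ some .lt) : Y.Sublist (e ++ R) ↔ Y.Sublist R := by
  rcases he with rfl | rfl
  · rfl
  · cases Y with
    | nil => simp
    | cons a Y =>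
      have : a ≠ .lt := by simpa using hY
      rw [List.singleton_append, List.cons_sublist_cons']
      simp [this]

theorem lt_prefix_inj {e₁ e₂ R₁ R₂ : List Ordering} (he₁ : e₁ = [] ∨ e₁ = [.lt])
    (he₂ : e₂ = [] ∨ e₂ = [.lt]) (h₁ : R₁.head? ≠ some .lt) (h₂ : R₂.head? ≠ some .lt)
    (h : e₁ ++ R₁ = e₂ ++ R₂) : e₁ = e₂ ∧ R₁ = R₂ := by
  rcases he₁ with rfl | rfl <;> rcases he₂ with rfl | rfl
  · simpa using h
  · simp at h; simp [h] at h₁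
  · simp at h; simp [← h] at h₂
  · simpa using h

theorem exists_lt_prefix (R : List Ordering) (hR : Reduced R) :
    ∃ e R', (e = [] ∨ e = [.lt]) ∧ R'.head? ≠ some .lt ∧ R = e ++ R' := by
  by_cases h : R.head? = some .lt
  · obtain ⟨R', rfl⟩ : ∃ R', R = .lt :: R' := by
      cases R with
      | nil => simp at h
      | cons a R => exact ⟨R, by simpa using h⟩
    have := (reduced_append_lt_cons (u := [])).1 hR
    exact ⟨[.lt], R', .inr rfl, this.2.2, rfl⟩
  · exact ⟨[], R, .inl rfl, h, rfl⟩

/-- After the first `lt`, exchange the two sides of the next `eq`. The right side then follows a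
`lt`, so a leading `lt` of it, recorded as `e`, has to stay behind the `eq`; since `Y` does not
begin with `lt`, it does not see `e`. -/
theorem triEquiv_lt_eq {Y : List Ordering} (hY : Y.head? ≠ some .lt) :
    TriEquiv (.lt :: .eq :: Y) (.lt :: (Y ++ [.eq])) := by
  refine TriEquiv.of_rel (fun w w' => (¬ [.lt, .eq].Sublist w ∧ w' = w) ∨
    ∃ u R₀ e R₁ : List Ordering, .lt ∉ u ∧ .eq ∉ R₀ ∧ (e = [] ∨ e = [.lt]) ∧
      R₀.head? ≠ some .lt ∧ R₁.head? ≠ some .lt ∧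
      w = u ++ .lt :: (R₀ ++ .eq :: (e ++ R₁)) ∧ w' = u ++ .lt :: (R₁ ++ .eq :: (e ++ R₀)))
    ?_ ?_ ?_ ?_
  · intro w hw
    by_cases h : [Ordering.lt, .eq].Sublist w
    · obtain ⟨u, v, rfl, hu⟩ := List.eq_append_cons_of_mem (h.subset (by simp : Ordering.lt ∈ _))
      rw [cons_sublist_append_cons hu, List.singleton_sublist] at h
      obtain ⟨R₀, R, rfl, hR₀⟩ := List.eq_append_cons_of_mem h
      rw [reduced_append_lt_cons, reduced_append_eq_cons] at hw
      obtain ⟨hu', ⟨h₀, hR⟩, hh⟩ := hw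
      obtain ⟨e, R₁, he, hR₁, rfl⟩ := exists_lt_prefix R hR
      have hh₀ : R₀.head? ≠ some .lt := by
        cases R₀ <;> simp_all
      refine ⟨_, ?_, .inr ⟨u, R₀, e, R₁, hu, hR₀, he, hh₀, hR₁, rfl, rfl⟩⟩
      rw [reduced_append_lt_cons, reduced_append_eq_cons, reduced_lt_prefix he hh₀]
      rw [reduced_lt_prefix he hR₁] at hR
      refine ⟨hu', ⟨hR, h₀⟩, ?_⟩
      cases R₁ <;> simp_all
    · exact ⟨w, hw, .inl ⟨h, rfl⟩⟩
  · have key : ∀ u R₀ R₁ : List Ordering, [Ordering.lt, .eq].Sublist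
        (u ++ .lt :: (R₀ ++ .eq :: R₁)) := fun u R₀ R₁ =>
      (List.Sublist.cons_cons _ (List.singleton_sublist.2 (by simp))).trans
        (List.sublist_append_right _ _)
    rintro w₁ w₂ w' - - (⟨h₁, rfl⟩ | ⟨u₁, R₁, e₁, S₁, hu₁, hR₁, he₁, hr₁, hs₁, rfl, rfl⟩)
      (⟨h₂, rfl⟩ | ⟨u₂, R₂, e₂, S₂, hu₂, hR₂, he₂, hr₂, hs₂, rfl, h⟩)
    · rfl
    · exact absurd (h ▸ key _ _ _) h₁
    · exact absurd (key _ _ _) h₂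
    · obtain ⟨rfl, h'⟩ := append_cons_inj_left hu₁ hu₂ h
      obtain ⟨h3, rfl⟩ := append_cons_inj_right
        (by rcases he₁ with rfl | rfl <;> simp [hR₁])
        (by rcases he₂ with rfl | rfl <;> simp [hR₂]) h'
      obtain ⟨rfl, rfl⟩ := lt_prefix_inj he₁ he₂ hr₁ hr₂ h3
      rfl
  · rintro w w' (⟨-, rfl⟩ | ⟨u, R₀, e, R₁, -, -, -, -, -, rfl, rfl⟩)
    · rfl
    · refine List.Perm.append_left _ (List.Perm.cons _ ?_)
      rw [List.perm_iff_count]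
      intro a
      simp only [List.count_append, List.count_cons]
      omega
  · rintro w w' (⟨h, rfl⟩ | ⟨u, R₀, e, R₁, hu, h₀, he, -, -, rfl, rfl⟩)
    · constructor
      · exact fun hs => absurd (List.Sublist.trans (by simp) hs) h
      · exact fun hs => absurd (List.Sublist.trans (by simp) hs) h
    · rw [cons_sublist_append_cons hu, cons_sublist_append_cons hu, cons_sublist_append_cons h₀,
        append_singleton_sublist_append_cons (by rcases he with rfl | rfl <;> simp [h₀]),
        sublist_lt_prefix he hY]

theorem triEquiv_reverse (X : List Ordering) : TriEquiv X X.reverse := by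
  refine TriEquiv.of_rel (fun w w' => w' = w.reverse) ?_ ?_ ?_ ?_
  · refine fun w hw => ⟨_, ?_, rfl⟩
    unfold Reduced at *
    rw [List.isChain_reverse]
    exact hw.imp fun a b h => fun e => e ▸ h e.symm
  · rintro w₁ w₂ w' - - rfl h
    exact List.reverse_injective h
  · rintro w w' rfl
    exact List.reverse_perm w
  · rintro w w' rfl
    rw [List.reverse_sublist]

/-! ### The words arising from the patterns -/

/-- The word `M^p x M^q y M^r`, where `M` stands for `eq`. -/
def triWord (x y : Ordering) (p q r : ℕ) : List Ordering :=
  List.replicate p .eq ++ x :: (List.replicate q .eq ++ y :: List.replicate r .eq)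

theorem triWord_succ_right (x y : Ordering) (p q r : ℕ) :
    triWord x y p q (r + 1) = triWord x y p q r ++ [.eq] := by
  simp [triWord, List.replicate_succ']

theorem triEquiv_triWord_succ_left (x y : Ordering) (p q r : ℕ) :
    TriEquiv (triWord x y (p + 1) q r) (triWord x y p q (r + 1)) := by
  rw [triWord_succ_right]
  exact triEquiv_eq_cons (triWord x y p q r)

theorem triEquiv_triWord_succ_mid (q r : ℕ) :
    TriEquiv (triWord .lt .gt 0 (q + 1) r) (triWord .lt .gt 0 q (r + 1)) := by
  rw [triWord_succ_right]
  refine triEquiv_lt_eq (Y := List.replicate q .eq ++ .gt :: List.replicate r .eq) ?_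
  cases q <;> simp [List.replicate_succ]

/-- Every `eq` can be moved to the right end, which leaves only the total number. -/
theorem triEquiv_triWord_zero (p q r : ℕ) :
    TriEquiv (triWord .lt .gt p q r) (triWord .lt .gt 0 0 (p + q + r)) := by
  induction p generalizing r with
  | zero =>
    induction q generalizing r with
    | zero => simpa using TriEquiv.refl _
    | succ q ih =>
      have := (triEquiv_triWord_succ_mid q r).trans (ih (r + 1))
      rwa [show 0 + q + (r + 1) = 0 + (q + 1) + r by omega] at this
  | succ p ih =>
    have := (triEquiv_triWord_succ_left _ _ p q r).trans (ih (r + 1))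
    rwa [show p + q + (r + 1) = p + 1 + q + r by omega] at this

theorem triEquiv_triWord_swap_zero (t : ℕ) :
    TriEquiv (triWord .lt .gt 0 0 t) (triWord .gt .lt 0 0 t) := by
  induction t with
  | zero => exact triEquiv_reverse _
  | succ t ih =>
    rw [triWord_succ_right, triWord_succ_right]
    exact ih.append_eq

theorem map_swap_triWord (x y : Ordering) (p q r : ℕ) :
    (triWord x y p q r).map Ordering.swap = triWord x.swap y.swap p q r := by
  simp [triWord]

theorem triEquiv_triWord {p q r p' q' r' : ℕ} (h : p + q + r = p' + q' + r') :
    TriEquiv (triWord .lt .gt p q r) (triWord .gt .lt p' q' r') := by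
  have h₁ := triEquiv_triWord_zero p q r
  have h₂ := (triEquiv_triWord_zero p' q' r').swap
  rw [map_swap_triWord, map_swap_triWord, ← h] at h₂
  exact (h₁.trans (triEquiv_triWord_swap_zero _)).trans h₂.symm

/-! ### Skeletons and their fillings -/

/-- `Fill κ m w A B v`: the word `v` arises from `w` by replacing the letters `lt` by the blocks `A`
of letters of class `lt`, the letters `gt` by the blocks `B` of letters of class `gt`, and the
letters `eq` by `m`. -/
inductive Fill {α : Type*} (κ : α → Ordering) (m : α) :
    List Ordering → List (List α) → List (List α) → List α → Prop
  | nil : Fill κ m [] [] [] []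
  | eq {w A B v} : Fill κ m w A B v → Fill κ m (.eq :: w) A B (m :: v)
  | lt {w A B v a} : a ≠ [] → (∀ x ∈ a, κ x = .lt) → Fill κ m w A B v →
      Fill κ m (.lt :: w) (a :: A) B (a ++ v)
  | gt {w A B v b} : b ≠ [] → (∀ x ∈ b, κ x = .gt) → Fill κ m w A B v →
      Fill κ m (.gt :: w) A (b :: B) (b ++ v)

section
variable {α : Type*} {κ : α → Ordering} {m : α}

theorem reduced_cons {a : Ordering} {w : List Ordering} :
    Reduced (a :: w) ↔ (w.head? = some a → a = .eq) ∧ Reduced w := by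
  unfold Reduced
  rw [List.isChain_cons]
  refine and_congr_left fun _ => ⟨fun h e => h a e rfl, ?_⟩
  rintro h y hy rfl
  exact h hy

theorem Fill.blocks {w A B v} (h : Fill κ m w A B v) :
    (∀ a ∈ A, a ≠ [] ∧ ∀ x ∈ a, κ x = .lt) ∧ (∀ b ∈ B, b ≠ [] ∧ ∀ x ∈ b, κ x = .gt) ∧
      A.length = w.count .lt ∧ B.length = w.count .gt := by
  induction h with
  | nil => simp
  | eq _ ih => simpa using ih
  | lt ha hx _ ih =>
    refine ⟨?_, ih.2.1, by simp [ih.2.2.1], by simpa using ih.2.2.2⟩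
    simpa using ⟨⟨ha, hx⟩, ih.1⟩
  | gt ha hx _ ih =>
    refine ⟨ih.1, ?_, by simpa using ih.2.2.1, by simp [ih.2.2.2]⟩
    simpa using ⟨⟨ha, hx⟩, ih.2.1⟩

theorem exists_fill {w : List Ordering} {A B : List (List α)}
    (hA : ∀ a ∈ A, a ≠ [] ∧ ∀ x ∈ a, κ x = .lt) (hB : ∀ b ∈ B, b ≠ [] ∧ ∀ x ∈ b, κ x = .gt)
    (hA' : A.length = w.count .lt) (hB' : B.length = w.count .gt) : ∃ v, Fill κ m w A B v := by
  induction w generalizing A B with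
  | nil =>
    obtain rfl : A = [] := by simpa using hA'
    obtain rfl : B = [] := by simpa using hB'
    exact ⟨_, .nil⟩
  | cons o w ih =>
    cases o with
    | eq =>
      obtain ⟨v, hv⟩ := ih hA hB (by simpa using hA') (by simpa using hB')
      exact ⟨_, hv.eq⟩
    | lt =>
      cases A with
      | nil => simp at hA'
      | cons a A =>
        simp only [List.mem_cons, forall_eq_or_imp] at hA
        obtain ⟨v, hv⟩ := ih hA.2 hB (by simpa using hA') (by simpa using hB')
        exact ⟨_, hv.lt hA.1.1 hA.1.2⟩
    | gt =>
      cases B with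
      | nil => simp at hB'
      | cons a A =>
        simp only [List.mem_cons, forall_eq_or_imp] at hB
        obtain ⟨v, hv⟩ := ih hA hB.2 (by simpa using hA') (by simpa using hB')
        exact ⟨_, hv.gt hB.1.1 hB.1.2⟩

theorem Fill.exists_of_perm {w w' A B v} (h : Fill κ m w A B v) (hw : w'.Perm w) :
    ∃ v', Fill κ m w' A B v' := by
  obtain ⟨h₁, h₂, h₃, h₄⟩ := h.blocks
  exact exists_fill h₁ h₂ (h₃.trans (hw.count_eq _).symm) (h₄.trans (hw.count_eq _).symm)

theorem Fill.swap {w A B v} (h : Fill κ m w A B v) :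
    Fill (fun x => (κ x).swap) m (w.map Ordering.swap) B A v := by
  induction h with
  | nil => exact .nil
  | eq _ ih => exact ih.eq
  | lt ha hx _ ih => exact ih.gt ha fun x h => by rw [hx x h]; rfl
  | gt ha hx _ ih => exact ih.lt ha fun x h => by rw [hx x h]; rfl

theorem Fill.perm {w A B v} (h : Fill κ m w A B v) :
    v.Perm (List.replicate (w.count .eq) m ++ (A.flatten ++ B.flatten)) := by
  classical
  rw [List.perm_iff_count]
  intro x
  induction h with
  | nil => simp
  | eq _ ih =>
    rw [List.count_cons_self, List.replicate_succ, List.cons_append, List.count_cons,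
      List.count_cons, ih]
  | lt ha hx _ ih => simp at *; omega
  | gt ha hx _ ih => simp at *; omega

theorem Fill.filter_gt (hm : κ m = .eq) {w A B v} (h : Fill κ m w A B v) :
    v.filter (fun x => κ x = .gt) = B.flatten := by
  induction h with
  | nil => simp
  | eq _ ih => simpa [hm] using ih
  | lt ha hx _ ih =>
    rw [List.filter_append, ih, List.filter_eq_nil_iff.2, List.nil_append]
    intro x hx'; simp [hx x hx']
  | gt ha hx _ ih =>
    rw [List.filter_append, ih, List.filter_eq_self.2, List.flatten_cons]
    intro x hx'; simp [hx x hx']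

theorem exists_parse (hκ : ∀ x, κ x = .eq → x = m) (v : List α) :
    ∃ w A B, Reduced w ∧ Fill κ m w A B v := by
  induction v with
  | nil => exact ⟨_, _, _, by simp [Reduced], .nil⟩
  | cons x v ih =>
    obtain ⟨w, A, B, hw, h⟩ := ih
    rcases hx : κ x with _ | _ | _
    · by_cases hh : w.head? = some .lt
      · cases h with
        | nil => simp at hh
        | eq _ => simp at hh
        | gt => simp at hh
        | @lt w A B v a ha ha' h =>
          exact ⟨_, _, _, hw, h.lt (a := x :: a) (by simp) (by simpa using ⟨hx, ha'⟩)⟩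
      · exact ⟨_, _, _, reduced_cons.2 ⟨fun h => absurd h hh, hw⟩,
          h.lt (a := [x]) (by simp) (by simpa using hx)⟩
    · obtain rfl := hκ x hx
      exact ⟨_, _, _, reduced_cons.2 ⟨fun _ => rfl, hw⟩, h.eq⟩
    · by_cases hh : w.head? = some .gt
      · cases h with
        | nil => simp at hh
        | eq _ => simp at hh
        | lt => simp at hh
        | @gt w A B v a ha ha' h =>
          exact ⟨_, _, _, hw, h.gt (b := x :: a) (by simp) (by simpa using ⟨hx, ha'⟩)⟩
      · exact ⟨_, _, _, reduced_cons.2 ⟨fun h => absurd h hh, hw⟩,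
          h.gt (b := [x]) (by simp) (by simpa using hx)⟩

theorem Fill.head_class (hm : κ m = .eq) {w A B v} (h : Fill κ m w A B v) :
    v.head?.map κ = w.head? := by
  cases h with
  | nil => rfl
  | eq _ => simp [hm]
  | @lt _ _ _ _ a ha hx _ => cases a <;> simp_all
  | @gt _ _ _ _ a ha hx _ => cases a <;> simp_all

theorem block_unique {c : Ordering} {a b v v' : List α} (ha : ∀ x ∈ a, κ x = c)
    (hb : ∀ x ∈ b, κ x = c) (hv : v.head?.map κ ≠ some c) (hv' : v'.head?.map κ ≠ some c)
    (h : a ++ v = b ++ v') : a = b ∧ v = v' := by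
  induction a generalizing b with
  | nil =>
    cases b with
    | nil => exact ⟨rfl, h⟩
    | cons y b =>
      simp only [List.nil_append] at h
      simp [h, hb y (by simp)] at hv
  | cons x a ih =>
    cases b with
    | nil =>
      simp only [List.nil_append] at h
      simp [← h, ha x (by simp)] at hv'
    | cons y b =>
      simp only [List.mem_cons, forall_eq_or_imp, List.cons_append, List.cons.injEq] at *
      obtain ⟨rfl, rfl⟩ := ih ha.2 hb.2 h.2
      exact ⟨⟨h.1, rfl⟩, rfl⟩

/-- Over a reduced skeleton the blocks are exactly the maximal runs of one class. -/
theorem Fill.unique (hm : κ m = .eq) {w A B v w' A' B'} (h : Fill κ m w A B v)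
    (h' : Fill κ m w' A' B' v) (hw : Reduced w) (hw' : Reduced w') :
    w = w' ∧ A = A' ∧ B = B' := by
  induction h generalizing w' A' B' with
  | nil =>
    have hh := h'.head_class hm
    generalize hv : ([] : List α) = u at h' hh
    cases h' with
    | nil => exact ⟨rfl, rfl, rfl⟩
    | _ => simp [← hv] at hh
  | @eq w A B v h ih =>
    have hh := h'.head_class hm
    generalize hv : m :: v = u at h'
    cases h' with
    | nil => simp at hv
    | eq h' =>
      simp only [List.cons.injEq, true_and] at hv
      subst hv
      obtain ⟨rfl, rfl, rfl⟩ := ih h' (reduced_cons.1 hw).2 (reduced_cons.1 hw').2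
      exact ⟨rfl, rfl, rfl⟩
    | lt => simp [hm] at hh
    | gt => simp [hm] at hh
  | @lt w A B v a ha hx h ih =>
    have hh := h'.head_class hm
    have hh' := (h.lt ha hx).head_class hm
    generalize hv : a ++ v = u at h' hh hh'
    cases h' with
    | nil => simp at hh'
    | eq _ => simp [hm] at hh'
    | gt => exact absurd (hh.symm.trans hh') (by simp)
    | lt ha' hx' h' =>
      rw [reduced_cons] at hw hw'
      obtain ⟨rfl, rfl⟩ := block_unique hx hx'
        (by rw [h.head_class hm]; exact fun h => by simpa using hw.1 h)
        (by rw [h'.head_class hm]; exact fun h => by simpa using hw'.1 h) hv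
      obtain ⟨rfl, rfl, rfl⟩ := ih h' hw.2 hw'.2
      exact ⟨rfl, rfl, rfl⟩
  | @gt w A B v a ha hx h ih =>
    have hh := h'.head_class hm
    have hh' := (h.gt ha hx).head_class hm
    generalize hv : a ++ v = u at h' hh hh'
    cases h' with
    | nil => simp at hh'
    | eq _ => simp [hm] at hh'
    | lt => exact absurd (hh.symm.trans hh') (by simp)
    | gt ha' hx' h' =>
      rw [reduced_cons] at hw hw'
      obtain ⟨rfl, rfl⟩ := block_unique hx hx'
        (by rw [h.head_class hm]; exact fun h => by simpa using hw.1 h)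
        (by rw [h'.head_class hm]; exact fun h => by simpa using hw'.1 h) hv
      obtain ⟨rfl, rfl, rfl⟩ := ih h' hw.2 hw'.2
      exact ⟨rfl, rfl, rfl⟩

theorem Fill.functional {w A B v v'} (h : Fill κ m w A B v) (h' : Fill κ m w A B v') :
    v = v' := by
  induction h generalizing v' with
  | nil => cases h'; rfl
  | eq _ ih => cases h' with | eq h' => rw [ih h']
  | lt _ _ _ ih => cases h' with | lt _ _ h' => rw [ih h']
  | gt _ _ _ ih => cases h' with | gt _ _ h' => rw [ih h']

/-- A reduced word uses at most one letter of a run of `c ≠ eq`, so the run may be contracted. -/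
theorem sublist_constant_append {c : Ordering} (hc : c ≠ .eq) {a : List Ordering} (ha : a ≠ [])
    (hac : ∀ x ∈ a, x = c) {Y w : List Ordering}
    (h : ∀ X, Reduced X → (X.Sublist Y ↔ X.Sublist w)) {X : List Ordering} (hX : Reduced X) :
    X.Sublist (a ++ Y) ↔ X.Sublist (c :: w) := by
  have key : ∀ {X}, Reduced X → X.head? ≠ some c → ∀ a : List Ordering, (∀ x ∈ a, x = c) →
      (X.Sublist (a ++ Y) ↔ X.Sublist Y) := by
    intro X hX hh a ha
    induction a with
    | nil => rfl
    | cons y a ih =>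
      simp only [List.mem_cons, forall_eq_or_imp] at ha
      obtain ⟨rfl, ha⟩ := ha
      rw [← ih ha]
      cases X with
      | nil => simp
      | cons x X =>
        have : x ≠ y := by simpa using hh
        rw [List.cons_append, List.cons_sublist_cons']
        simp [this]
  by_cases hh : X.head? = some c
  · obtain ⟨X, rfl⟩ : ∃ X', X = c :: X' := by
      cases X with
      | nil => simp at hh
      | cons x X => exact ⟨X, by simpa using hh⟩
    cases a with
    | nil => exact absurd rfl ha
    | cons y a =>
      simp only [List.mem_cons, forall_eq_or_imp] at hac
      obtain ⟨rfl, hac⟩ := hac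
      rw [reduced_cons] at hX
      rw [List.cons_append, List.cons_sublist_cons, List.cons_sublist_cons,
        key hX.2 (fun h => hc (hX.1 h)) a hac, h X hX.2]
  · rw [key hX hh a hac, h X hX]
    cases X with
    | nil => simp
    | cons x X =>
      have : x ≠ c := by simpa using hh
      rw [List.cons_sublist_cons']
      simp [this]

theorem Fill.sublist_map (hm : κ m = .eq) {w A B v} (h : Fill κ m w A B v)
    {X : List Ordering} (hX : Reduced X) : X.Sublist (v.map κ) ↔ X.Sublist w := by
  induction h generalizing X with
  | nil => simp
  | eq _ ih =>
    rw [List.map_cons, hm]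
    cases X with
    | nil => simp
    | cons x X =>
      rw [List.cons_sublist_cons', List.cons_sublist_cons', ih hX, ih (reduced_cons.1 hX).2]
  | lt ha hx _ ih =>
    rw [List.map_append]
    exact sublist_constant_append (by simp) (by simpa using ha) (by simpa using hx)
      (fun X hX => ih hX) hX
  | gt ha hx _ ih =>
    rw [List.map_append]
    exact sublist_constant_append (by simp) (by simpa using ha) (by simpa using hx)
      (fun X hX => ih hX) hX

/-! ### Invisibility at the other levels -/

/-- No two consecutive letters `c`, and the last letter is not `c`. -/
def Separated (c : Ordering) (X : List Ordering) : Prop :=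
  (X.IsChain fun a b => ¬(a = c ∧ b = c)) ∧ X.getLast? ≠ some c

theorem Separated.of_append {c : Ordering} {X Y : List Ordering} (h : Separated c (X ++ Y)) :
    Separated c Y := by
  refine ⟨h.1.right_of_append, fun e => h.2 ?_⟩
  rw [List.getLast?_append, e]; rfl

theorem sublist_append_congr_right {c : Ordering} {y z : List Ordering}
    (h : ∀ X, Separated c X → (X.Sublist y ↔ X.Sublist z)) (u : List Ordering)
    {X : List Ordering} (hX : Separated c X) : X.Sublist (u ++ y) ↔ X.Sublist (u ++ z) := by
  simp only [List.sublist_append_iff]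
  constructor <;>
  · rintro ⟨X₁, X₂, rfl, h₁, h₂⟩
    have := h X₂ hX.of_append
    exact ⟨X₁, X₂, rfl, h₁, by tauto⟩

theorem sublist_cons_replicate_append {c : Ordering} {X Y u : List Ordering}
    (hu : ∀ x ∈ u, x = c) (hX : Separated c X) :
    X.Sublist (c :: (u ++ Y)) ↔ X.Sublist (c :: Y) := by
  induction u with
  | nil => rfl
  | cons y u ih =>
    simp only [List.mem_cons, forall_eq_or_imp] at hu
    obtain ⟨rfl, hu⟩ := hu
    rw [← ih hu]
    refine ⟨fun h => ?_, fun h => h.trans (by simp)⟩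
    cases h with
    | cons _ h => exact h
    | @cons_cons X _ _ h =>
      cases h with
      | cons _ h => exact h.cons_cons _
      | cons_cons _ h => simp [Separated] at hX

theorem sublist_append_last {c : Ordering} {X u : List Ordering} (hX : Separated c X) :
    X.Sublist (u ++ [c]) ↔ X.Sublist u := by
  refine ⟨fun h => ?_, fun h => h.trans (by simp)⟩
  rw [List.sublist_append_iff] at h
  obtain ⟨X₁, X₂, rfl, h₁, h₂⟩ := h
  rw [List.sublist_singleton] at h₂
  rcases h₂ with rfl | rfl
  · simpa using h₁
  · exact absurd (by simp) hX.2

/-- A collapsed form of `c :: v.map g`, where `A` lists the blocks of `v` not mapped to `c`. -/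
def blockWord (g : α → Ordering) (c : Ordering) (A : List (List α)) : List Ordering :=
  c :: A.flatMap fun a => a.map g ++ [c]

/-- The right side depends only on `A`: the skeleton matters only through the runs of `c` between
blocks. These are nonempty by reducedness, and their lengths are invisible to separated words. -/
theorem Fill.sublist_blockWord {g : α → Ordering} {c : Ordering} (hm : g m = c)
    (hg : ∀ x, κ x = .gt → g x = c) {w A B v} (h : Fill κ m w A B v) (hw : Reduced w) :
    ∀ X, Separated c X → (X.Sublist (c :: v.map g) ↔ X.Sublist (blockWord g c A)) := by
  -- The induction needs a second half: if the skeleton does not begin with `lt`, then `v` itself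
  -- supplies the first `c` of `blockWord`, whatever the prefix `u`. For empty `v` it does not, but
  -- that `c` is final and hence invisible.
  have key : ∀ w A B v, Fill κ m w A B v → Reduced w →
      ((∀ X, Separated c X → (X.Sublist (c :: v.map g) ↔ X.Sublist (blockWord g c A))) ∧
      (w.head? ≠ some .lt → ∀ u : List Ordering, ∀ X, Separated c X →
        (X.Sublist (u ++ v.map g) ↔ X.Sublist (u ++ blockWord g c A)))) := by
    intro w A B v h hw
    have step : ∀ {v : List α} {A : List (List α)} {b : List α}, b ≠ [] → (∀ x ∈ b, g x = c) →
        (∀ X, Separated c X → (X.Sublist (c :: v.map g) ↔ X.Sublist (blockWord g c A))) →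
        (∀ X, Separated c X → (X.Sublist (c :: (b ++ v).map g) ↔ X.Sublist (blockWord g c A))) ∧
        (∀ u : List Ordering, ∀ X, Separated c X →
          (X.Sublist (u ++ (b ++ v).map g) ↔ X.Sublist (u ++ blockWord g c A))) := by
      intro v A b hb hbc ih
      refine ⟨fun X hX => ?_, fun u X hX => sublist_append_congr_right (fun X hX => ?_) u hX⟩
      · rw [List.map_append, sublist_cons_replicate_append (by simpa using hbc) hX, ih X hX]
      · cases b with
        | nil => exact absurd rfl hb
        | cons x b =>
          simp only [List.mem_cons, forall_eq_or_imp] at hbc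
          rw [List.cons_append, List.map_cons, List.map_append, hbc.1,
            sublist_cons_replicate_append (by simpa using hbc.2) hX, ih X hX]
    induction h with
    | nil =>
      refine ⟨fun X hX => by simp [blockWord], fun _ u X hX => ?_⟩
      simp only [List.map_nil, List.append_nil, blockWord, List.flatMap_nil]
      exact (sublist_append_last hX).symm
    | @eq w A B v h ih =>
      have := step (b := [m]) (by simp) (by simpa using hm) (ih (reduced_cons.1 hw).2).1
      exact ⟨this.1, fun _ => this.2⟩
    | gt hb hx h ih =>
      have := step hb (fun x h => hg x (hx x h)) (ih (reduced_cons.1 hw).2).1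
      exact ⟨this.1, fun _ => this.2⟩
    | @lt w A B v a ha hx h ih =>
      rw [reduced_cons] at hw
      refine ⟨fun X hX => ?_, fun h => absurd rfl h⟩
      have := (ih hw.2).2 (fun h => by simpa using hw.1 h) (c :: a.map g) X hX
      simpa [blockWord] using this
  exact (key w A B v h hw).1

end
-- Restricted growth words and exchange level by level
/-- `RG k w`: the word `w` continues a restricted growth word with maximum `k`. -/
def RG : ℕ → List ℕ → Prop
  | _, [] => True
  | k, a :: w => 1 ≤ a ∧ a ≤ k + 1 ∧ RG (max k a) w

theorem RG.append_iff {k : ℕ} {u v : List ℕ} :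
    RG k (u ++ v) ↔ RG k u ∧ RG (u.foldl max k) v := by
  induction u generalizing k with
  | nil => simp [RG]
  | cons a u ih => simp [RG, ih, and_assoc]

/-- Letters up to `m ≤ k` never raise the maximum, so only the letters above `m` are constrained in
their order. -/
theorem RG.iff_filter {m k : ℕ} (hk : m ≤ k) {v : List ℕ} :
    RG k v ↔ (∀ x ∈ v, 1 ≤ x) ∧ RG k (v.filter fun x => compare x m = .gt) := by
  induction v generalizing k with
  | nil => simp [RG]
  | cons a v ih =>
    by_cases h : m < a
    · rw [List.filter_cons_of_pos (by simpa [compare_gt_iff_gt] using h)]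
      simp only [RG, List.mem_cons, forall_eq_or_imp, ih (hk.trans (le_max_left k a))]
      tauto
    · rw [List.filter_cons_of_neg (by simpa [compare_gt_iff_gt] using h)]
      simp only [RG, List.mem_cons, forall_eq_or_imp, max_eq_left ((not_lt.1 h).trans hk), ← ih hk,
        and_assoc]
      refine and_congr_right fun _ => ⟨fun h' => h'.2, fun h' => ⟨by omega, h'⟩⟩

theorem RG.le_add_length {k : ℕ} {x : List ℕ} (h : RG k x) : ∀ a ∈ x, a ≤ k + x.length := by
  induction x generalizing k with
  | nil => simp
  | cons b x ih =>
    obtain ⟨h₁, h₂, h₃⟩ := h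
    simp only [List.mem_cons, forall_eq_or_imp, List.length_cons]
    refine ⟨by omega, fun a ha => ?_⟩
    have := ih h₃ a ha
    omega

theorem finite_RG (n : ℕ) : {x : List ℕ | RG 0 x ∧ x.length = n}.Finite := by
  refine ((List.finite_length_eq (Fin (n + 1)) n).image (List.map Fin.val)).subset ?_
  rintro x ⟨h, hn⟩
  have hle := h.le_add_length
  refine ⟨x.map (Fin.ofNat (n + 1)), by simpa using hn, ?_⟩
  rw [List.map_map]
  refine (List.map_congr_left fun a ha => ?_).trans (List.map_id x)
  have := hle a ha
  simp only [Function.comp, Fin.ofNat, id]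
  exact Nat.mod_eq_of_lt (by omega)

theorem ncard_le_of_rel {α : Type*} {S T : Set α} (ρ : α → α → Prop) (hT : T.Finite)
    (total : ∀ x ∈ S, ∃ y ∈ T, ρ x y) (inj : ∀ x x' y, ρ x y → ρ x' y → x = x') :
    S.ncard ≤ T.ncard := by
  choose! f hf hρ using total
  exact Set.ncard_le_ncard_of_injOn f hf
    (fun a ha b hb h => inj a b (f a) (hρ a ha) (h ▸ hρ b hb)) hT

/-- The letters of `x`, as lying below, at or above level `j`. -/
abbrev levelWord (j : ℕ) (x : List ℕ) : List Ordering := x.map fun a => compare a j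

/-- Restricted growth words of length `n` such that `eq :: N` is avoided at the levels below `m`,
`eq :: X` at level `m`, and `eq :: P` at the levels above. -/
def hybrid (m n : ℕ) (N X P : List Ordering) : Set (List ℕ) :=
  {x | (RG 0 x ∧ x.length = n) ∧ (∀ j < m, ¬ (Ordering.eq :: N).Sublist (levelWord j x)) ∧
    ¬ (Ordering.eq :: X).Sublist (levelWord m x) ∧
    ∀ j > m, ¬ (Ordering.eq :: P).Sublist (levelWord j x)}

theorem eq_mem_levelWord {j : ℕ} {x : List ℕ} : Ordering.eq ∈ levelWord j x ↔ j ∈ x := by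
  simp [levelWord]

theorem Fill.perm_of_perm {α : Type*} {κ : α → Ordering} {m : α} {w w' A B v v'}
    (h : Fill κ m w A B v) (h' : Fill κ m w' A B v') (hw : w'.Perm w) : v'.Perm v := by
  have := h'.perm
  rw [hw.count_eq] at this
  exact this.trans h.perm.symm

theorem Fill.sublist_lower {m j : ℕ} (hj : j < m) {w w' A B v v'}
    (h : Fill (fun a => compare a m) m w A B v) (h' : Fill (fun a => compare a m) m w' A B v')
    (hw : Reduced w) (hw' : Reduced w') {N : List Ordering} (hN : Separated .gt N) (u : List ℕ) :
    N.Sublist (levelWord j (u ++ m :: v)) ↔ N.Sublist (levelWord j (u ++ m :: v')) := by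
  have hm : compare m j = .gt := compare_gt_iff_gt.2 hj
  have hg : ∀ x, compare x m = .gt → compare x j = .gt := fun x hx =>
    compare_gt_iff_gt.2 (hj.trans (compare_gt_iff_gt.1 hx))
  simp only [levelWord, List.map_append, List.map_cons, hm]
  refine sublist_append_congr_right (fun X hX => ?_) _ hN
  rw [h.sublist_blockWord (g := fun a => compare a j) hm hg hw X hX,
    h'.sublist_blockWord (g := fun a => compare a j) hm hg hw' X hX]

/-- The mirror image of the lower case: swapping `lt` and `gt` exchanges the roles of `A` and `B`.
-/
theorem Fill.sublist_upper {m j : ℕ} (hj : m < j) {w w' A B v v'}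
    (h : Fill (fun a => compare a m) m w A B v) (h' : Fill (fun a => compare a m) m w' A B v')
    (hw : Reduced w) (hw' : Reduced w') {P : List Ordering} (hP : Separated .lt P) (u : List ℕ) :
    P.Sublist (levelWord j (u ++ m :: v)) ↔ P.Sublist (levelWord j (u ++ m :: v')) := by
  have hm : compare m j = .lt := compare_lt_iff_lt.2 hj
  have hg : ∀ x, (compare x m).swap = .gt → compare x j = .lt := fun x hx =>
    compare_lt_iff_lt.2 (lt_trans (compare_lt_iff_lt.1 (Ordering.swap_inj.1 hx)) hj)
  simp only [levelWord, List.map_append, List.map_cons, hm]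
  refine sublist_append_congr_right (fun X hX => ?_) _ hP
  rw [h.swap.sublist_blockWord (g := fun a => compare a j) hm hg (reduced_map_swap hw) X hX,
    h'.swap.sublist_blockWord (g := fun a => compare a j) hm hg (reduced_map_swap hw') X hX]

theorem Fill.sublist_level {m : ℕ} {w A B v} (h : Fill (fun a => compare a m) m w A B v)
    {X : List Ordering} (hX : Reduced X) {u : List ℕ} (hu : m ∉ u) :
    (Ordering.eq :: X).Sublist (levelWord m (u ++ m :: v)) ↔ X.Sublist w := by
  rw [levelWord, List.map_append, List.map_cons, compare_eq_iff_eq.2 rfl,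
    cons_sublist_append_cons (eq_mem_levelWord.not.2 hu), 
    h.sublist_map (κ := fun a => compare a m) (compare_eq_iff_eq.2 rfl) hX]

theorem RG.of_fill {m : ℕ} {w w' A B v v'} (h : Fill (fun a => compare a m) m w A B v)
    (h' : Fill (fun a => compare a m) m w' A B v') (hw : w'.Perm w) {u : List ℕ}
    (hx : RG 0 (u ++ m :: v)) : RG 0 (u ++ m :: v') := by
  have hm : compare m m = .eq := compare_eq_iff_eq.2 rfl
  rw [RG.append_iff] at hx ⊢
  refine ⟨hx.1, hx.2.1, hx.2.2.1, ?_⟩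
  have hv := hx.2.2.2
  rw [RG.iff_filter (le_max_right _ m)] at hv ⊢
  refine ⟨fun x hx => hv.1 x ((h.perm_of_perm h' hw).subset hx), ?_⟩
  rw [h'.filter_gt (κ := fun a => compare a m) hm, ← h.filter_gt (κ := fun a => compare a m) hm]
  exact hv.2

theorem ncard_hybrid_le (m n : ℕ) {N X Y P : List Ordering} (hXY : TriEquiv X Y) (hX : Reduced X)
    (hY : Reduced Y) (hN : Separated .gt (.eq :: N)) (hP : Separated .lt (.eq :: P)) :
    (hybrid m n N X P).ncard ≤ (hybrid m n N Y P).ncard := by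
  obtain ⟨φ, hφ⟩ := hXY
  have hm : compare m m = .eq := compare_eq_iff_eq.2 rfl
  refine ncard_le_of_rel (fun x y => (m ∉ x ∧ y = x) ∨
    ∃ (u : List ℕ) (w : {w // Reduced w}) (A B : List (List ℕ)) (v v' : List ℕ), m ∉ u ∧
      Fill (fun a => compare a m) m w.1 A B v ∧ Fill (fun a => compare a m) m (φ w).1 A B v' ∧
      x = u ++ m :: v ∧ y = u ++ m :: v') ((finite_RG n).subset fun x hx => hx.1) ?_ ?_
  · rintro x ⟨⟨hx, hn⟩, hlow, hlev, hup⟩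
    by_cases hmx : m ∈ x
    · obtain ⟨u, v, rfl, hu⟩ := List.eq_append_cons_of_mem hmx
      obtain ⟨w, A, B, hw, hv⟩ := exists_parse (κ := fun a => compare a m)
        (fun x hx => compare_eq_iff_eq.1 hx) v
      obtain ⟨hp, hs⟩ := hφ ⟨w, hw⟩
      obtain ⟨v', hv'⟩ := hv.exists_of_perm hp
      refine ⟨_, ⟨⟨hx.of_fill hv hv' hp, ?_⟩, fun j hj h => hlow j hj ?_, fun h => hlev ?_,
        fun j hj h => hup j hj ?_⟩, .inr ⟨u, ⟨w, hw⟩, A, B, v, v', hu, hv, hv', rfl, rfl⟩⟩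
      · simpa [(hv.perm_of_perm hv' hp).length_eq] using hn
      · exact (hv.sublist_lower hj hv' hw (φ ⟨w, hw⟩).2 hN u).2 h
      · rw [hv'.sublist_level hY hu] at h
        exact (hv.sublist_level hX hu).2 (hs.2 h)
      · exact (hv.sublist_upper hj hv' hw (φ ⟨w, hw⟩).2 hP u).2 h
    · exact ⟨x, ⟨⟨hx, hn⟩, hlow, fun h => hmx (eq_mem_levelWord.1 (h.subset (by simp))), hup⟩,
        .inl ⟨hmx, rfl⟩⟩
  · rintro x x' y (⟨h₁, rfl⟩ | ⟨u₁, w₁, A₁, B₁, v₁, v₁', hu₁, hv₁, hv₁', rfl, rfl⟩)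
      (⟨h₂, rfl⟩ | ⟨u₂, w₂, A₂, B₂, v₂, v₂', hu₂, hv₂, hv₂', rfl, h⟩)
    · rfl
    · simp [h] at h₁
    · simp at h₂
    · obtain ⟨rfl, rfl⟩ := append_cons_inj_left hu₁ hu₂ h
      obtain ⟨hw, rfl, rfl⟩ := Fill.unique (κ := fun a => compare a m) hm hv₁' hv₂' (φ w₁).2 (φ w₂).2
      obtain rfl := φ.injective (Subtype.ext hw)
      rw [hv₁.functional hv₂]

theorem ncard_hybrid_eq (m n : ℕ) {N X Y P : List Ordering} (hXY : TriEquiv X Y) (hX : Reduced X)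
    (hY : Reduced Y) (hN : Separated .gt (.eq :: N)) (hP : Separated .lt (.eq :: P)) :
    (hybrid m n N X P).ncard = (hybrid m n N Y P).ncard :=
  le_antisymm (ncard_hybrid_le m n hXY hX hY hN hP) (ncard_hybrid_le m n hXY.symm hY hX hN hP)

/-- Restricted growth words of length `n` that avoid `eq :: X` at every level. -/
def levelAvoiders (n : ℕ) (X : List Ordering) : Set (List ℕ) :=
  {x | (RG 0 x ∧ x.length = n) ∧ ∀ j, ¬ (Ordering.eq :: X).Sublist (levelWord j x)}

/-- The hybrid sets have `Y` below the current level and `X` above it, which is the arrangement that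
the two separation hypotheses allow. -/
theorem ncard_levelAvoiders (n : ℕ) {X Y : List Ordering} (hXY : TriEquiv X Y) (hX : Reduced X)
    (hY : Reduced Y) (hN : Separated .gt (.eq :: Y)) (hP : Separated .lt (.eq :: X)) :
    (levelAvoiders n X).ncard = (levelAvoiders n Y).ncard := by
  have chain : ∀ k, (hybrid 0 n Y X X).ncard = (hybrid k n Y X X).ncard := by
    intro k
    induction k with
    | zero => rfl
    | succ k ih =>
      rw [ih, ncard_hybrid_eq k n hXY hX hY hN hP]
      congr 1
      ext x
      refine and_congr_right fun _ => ⟨?_, ?_⟩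
      · rintro ⟨h₁, h₂, h₃⟩
        refine ⟨fun j hj => ?_, h₃ _ (by omega), fun j hj => h₃ j (by omega)⟩
        rcases Nat.lt_succ_iff_lt_or_eq.1 hj with h | rfl
        exacts [h₁ j h, h₂]
      · rintro ⟨h₁, h₂, h₃⟩
        refine ⟨fun j hj => h₁ j (by omega), h₁ k (by omega), fun j hj => ?_⟩
        rcases Nat.eq_or_lt_of_le (Nat.succ_le_of_lt hj) with rfl | h
        exacts [h₂, h₃ j h]
  have h₀ : levelAvoiders n X = hybrid 0 n Y X X := by
    ext x
    refine and_congr_right fun _ => ⟨fun h => ⟨by simp, h 0, fun j _ => h j⟩, fun h j => ?_⟩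
    rcases Nat.eq_zero_or_pos j with rfl | hj
    exacts [h.2.1, h.2.2 j hj]
  -- Letters are at most `n`, so the levels from `n + 1` on impose nothing.
  have h₁ : levelAvoiders n Y = hybrid (n + 1) n Y X X := by
    ext x
    refine and_congr_right fun hx => ?_
    have big : ∀ Z : List Ordering, ∀ j ≥ n + 1, ¬ (Ordering.eq :: Z).Sublist (levelWord j x) := by
      intro Z j hj h
      have := hx.1.le_add_length j (eq_mem_levelWord.1 (h.subset (by simp)))
      omega
    refine ⟨fun h => ⟨fun j _ => h j, big _ _ le_rfl, fun j hj => big _ _ (le_of_lt hj)⟩,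
      fun h j => ?_⟩
    rcases Nat.lt_or_ge j (n + 1) with hj | hj
    exacts [h.1 j hj, big _ j hj]
  rw [h₀, h₁]
  exact chain _

theorem reduced_replicate_append (p : ℕ) (w : List Ordering) :
    Reduced (List.replicate p .eq ++ w) ↔ Reduced w := by
  induction p with
  | zero => rfl
  | succ p ih => rw [List.replicate_succ, List.cons_append, reduced_cons, ih]; simp

theorem reduced_triWord {x y : Ordering} (h : x ≠ y) (hx : x ≠ .eq) (p q r : ℕ) :
    Reduced (triWord x y p q r) := by
  rw [triWord, reduced_replicate_append, reduced_cons, reduced_replicate_append, reduced_cons,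
    ← List.append_nil (List.replicate r _), reduced_replicate_append]
  refine ⟨fun h' => ?_, fun h' => ?_, by simp [Reduced]⟩
  · cases q <;> simp_all [List.replicate_succ]
  · cases r <;> simp_all [List.replicate_succ]

theorem separated_append_cons {c : Ordering} {u v : List Ordering} (hu : c ∉ u) (hv : c ∉ v)
    (hne : v ≠ []) : Separated c (u ++ c :: v) := by
  constructor
  · refine List.Pairwise.isChain ?_
    rw [List.pairwise_append, List.pairwise_cons]
    refine ⟨List.pairwise_of_forall_mem_list ?_, ⟨?_, List.pairwise_of_forall_mem_list ?_⟩, ?_⟩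
    · rintro a ha b - ⟨rfl, -⟩
      exact hu ha
    · rintro b hb ⟨-, rfl⟩
      exact hv hb
    · rintro a ha b - ⟨rfl, -⟩
      exact hv ha
    · rintro a ha b - ⟨rfl, -⟩
      exact hu ha
  · rw [List.getLast?_append_of_ne_nil _ (by simp), List.getLast?_cons_of_ne_nil hne]
    exact fun h => hv (List.mem_of_getLast? h)

/-- The letter `x` occurs once and `y` comes after it, so `x` is neither doubled nor final. -/
theorem separated_triWord {x y : Ordering} (h : x ≠ y) (hx : x ≠ .eq) (p q r : ℕ) :
    Separated x (.eq :: triWord x y p q r) := by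
  refine separated_append_cons (u := .eq :: List.replicate p .eq) ?_ ?_ (by simp)
  · simp [hx]
  · simp [hx, h]

/-! ### Canonical sequences are the restricted growth words -/

theorem RG.ofFn_iff {n : ℕ} {k : ℕ} {c : Fin n → ℕ} :
    RG k (List.ofFn c) ↔ ∀ i, 1 ≤ c i ∧ ∀ v, k < v → v < c i → ∃ j < i, c j = v := by
  induction n generalizing k with
  | zero => simp [RG]
  | succ n ih =>
    rw [List.ofFn_succ, RG, ih, Fin.forall_fin_succ]
    constructor
    · rintro ⟨h₁, h₂, h₃⟩
      refine ⟨⟨h₁, fun v _ _ => by omega⟩, fun i => ⟨(h₃ i).1, fun v hv hvi => ?_⟩⟩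
      by_cases hv' : max k (c 0) < v
      · obtain ⟨j, hj, rfl⟩ := (h₃ i).2 v hv' hvi
        exact ⟨j.succ, Fin.succ_lt_succ_iff.2 hj, rfl⟩
      · exact ⟨0, Fin.succ_pos i, by omega⟩
    · rintro ⟨⟨h₁, h₂⟩, h₃⟩
      refine ⟨h₁, ?_, fun i => ⟨(h₃ i).1, fun v hv hvi => ?_⟩⟩
      · by_contra! h
        obtain ⟨j, hj, -⟩ := h₂ (k + 1) (by omega) (by omega)
        exact absurd hj (Fin.not_lt_zero j)
      · obtain ⟨j, hj, hjv⟩ := (h₃ i).2 v (by omega) hvi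
        refine j.cases (motive := fun j => j < i.succ → c j = v → ∃ j < i, c j.succ = v) ?_ ?_ hj hjv
        · intro _ h; omega
        · exact fun j hj h => ⟨j, Fin.succ_lt_succ_iff.1 hj, h⟩

/-- At a first difference the smaller value has already occurred in the word with the larger one;
equality of kernels then contradicts agreement at that earlier place. -/
theorem RG.eq_of_ker {n : ℕ} {c d : Fin n → ℕ} (hc : RG 0 (List.ofFn c))
    (hd : RG 0 (List.ofFn d)) (h : ∀ i j, c i = c j ↔ d i = d j) : c = d := by
  rw [RG.ofFn_iff] at hc hd
  funext i
  induction i using WellFoundedLT.induction with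
  | ind i ih =>
    rcases lt_trichotomy (c i) (d i) with hlt | heq | hgt
    · obtain ⟨j, hj, hji⟩ := (hd i).2 (c i) (hc i).1 hlt
      have := (h j i).1 ((ih j hj).trans hji)
      omega
    · exact heq
    · obtain ⟨j, hj, hji⟩ := (hc i).2 (d i) (hd i).1 hgt
      have := (h j i).2 ((ih j hj).symm.trans hji)
      omega

section Canonical
variable {n : ℕ} (P : Finpartition (Finset.univ : Finset (Fin n)))

/-- The position of a block when the blocks are ordered by their minima. -/
def blockRank (B : Finset (Fin n)) : ℕ :=
  (P.parts.filter fun C => C.min ≤ B.min).card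

variable {P}

theorem eq_of_min_eq {B C : Finset (Fin n)} (hB : B ∈ P.parts) (hC : C ∈ P.parts)
    (h : B.min = C.min) : B = C := by
  obtain ⟨b, hb⟩ := Finset.min_of_nonempty (P.nonempty_of_mem_parts hB)
  exact P.eq_of_mem_parts hB hC (Finset.mem_of_min hb) (Finset.mem_of_min (h ▸ hb))

theorem blockRank_lt {B C : Finset (Fin n)} (hC : C ∈ P.parts) (h : B.min < C.min) :
    blockRank P B < blockRank P C := by
  refine Finset.card_lt_card ⟨fun D hD => ?_, fun hs => ?_⟩
  · rw [Finset.mem_filter] at hD ⊢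
    exact ⟨hD.1, hD.2.trans h.le⟩
  · have := hs (Finset.mem_filter.2 ⟨hC, le_rfl⟩)
    exact absurd (Finset.mem_filter.1 this).2 (not_le.2 h)

theorem blockRank_injOn : Set.InjOn (blockRank P) P.parts := by
  intro B hB C hC h
  rcases lt_trichotomy B.min C.min with hlt | heq | hgt
  · exact absurd h (blockRank_lt hC hlt).ne
  · exact eq_of_min_eq hB hC heq
  · exact absurd h (blockRank_lt hB hgt).ne'

theorem blockRank_pos {B : Finset (Fin n)} (hB : B ∈ P.parts) : 1 ≤ blockRank P B :=
  Finset.card_pos.2 ⟨B, Finset.mem_filter.2 ⟨hB, le_rfl⟩⟩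

theorem exists_blockRank_eq {v : ℕ} (hv : 1 ≤ v) (hv' : v ≤ P.parts.card) :
    ∃ B ∈ P.parts, blockRank P B = v := by
  have := Finset.surjOn_of_injOn_of_card_le (s := P.parts) (t := Finset.Icc 1 P.parts.card)
    (blockRank P) (fun B hB => by
      simpa using ⟨blockRank_pos hB, Finset.card_le_card (Finset.filter_subset _ _)⟩)
    blockRank_injOn (by simp)
  obtain ⟨B, hB, h⟩ := this (show v ∈ _ by simpa using ⟨hv, hv'⟩)
  exact ⟨B, hB, h⟩

theorem canonicalSeq_eq_iff {i j : Fin n} :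
    canonicalSeq P i = canonicalSeq P j ↔ P.part i = P.part j :=
  ⟨fun h => blockRank_injOn (P.part_mem.2 (Finset.mem_univ i)) (P.part_mem.2 (Finset.mem_univ j)) h,
    fun h => by rw [canonicalSeq, h, canonicalSeq]⟩

theorem RG_canonicalSeq : RG 0 (List.ofFn (canonicalSeq P)) := by
  rw [RG.ofFn_iff]
  intro i
  have hi := P.part_mem.2 (Finset.mem_univ i)
  refine ⟨blockRank_pos hi, fun v hv hvi => ?_⟩
  obtain ⟨B, hB, rfl⟩ := exists_blockRank_eq (P := P) hv
    (hvi.le.trans (Finset.card_le_card (Finset.filter_subset _ _)))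
  obtain ⟨b, hb⟩ := Finset.min_of_nonempty (P.nonempty_of_mem_parts hB)
  have hpart : P.part b = B := P.part_eq_of_mem hB (Finset.mem_of_min hb)
  refine ⟨b, ?_, by rw [canonicalSeq, hpart]; rfl⟩
  have hlt : B.min < (P.part i).min := by
    by_contra! h
    rcases h.lt_or_eq with h | h
    · exact absurd (blockRank_lt hB h) (not_lt.2 hvi.le)
    · exact absurd (eq_of_min_eq hi hB h) fun e => hvi.ne (by rw [canonicalSeq, e]; rfl)
  have := hlt.trans_le (Finset.min_le (P.mem_part (Finset.mem_univ i)))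
  rw [hb] at this
  exact WithTop.coe_lt_coe.1 this

theorem canonicalSeq_injective : Function.Injective (canonicalSeq (n := n)) := by
  intro P Q h
  have hpart : ∀ i, P.part i = Q.part i := by
    intro i
    ext j
    rw [P.mem_part_iff_part_eq_part (Finset.mem_univ _) (Finset.mem_univ _),
      Q.mem_part_iff_part_eq_part (Finset.mem_univ _) (Finset.mem_univ _),
      ← canonicalSeq_eq_iff, ← canonicalSeq_eq_iff, h]
  have key : ∀ P Q : Finpartition (Finset.univ : Finset (Fin n)), (∀ i, P.part i = Q.part i) →
      P.parts ⊆ Q.parts := by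
    intro P Q h B hB
    obtain ⟨b, hb⟩ := P.nonempty_of_mem_parts hB
    rw [← P.part_eq_of_mem hB hb, h]
    exact Q.part_mem.2 (Finset.mem_univ b)
  exact Finpartition.ext ((key P Q hpart).antisymm (key Q P fun i => (hpart i).symm))

theorem exists_canonicalSeq_eq {c : Fin n → ℕ} (hc : RG 0 (List.ofFn c)) :
    ∃ P : Finpartition (Finset.univ : Finset (Fin n)), canonicalSeq P = c := by
  classical
  refine ⟨Finpartition.ofSetoid (Setoid.ker c), RG_canonicalSeq.eq_of_ker hc fun i j => ?_⟩
  rw [canonicalSeq_eq_iff, ← Finpartition.mem_part_iff_part_eq_part _ (Finset.mem_univ _)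
    (Finset.mem_univ _), Finpartition.mem_part_ofSetoid_iff_rel]
  exact eq_comm

end Canonical

/-! ### Pattern containment read off from levels -/

theorem contains_of_sublist {n : ℕ} {π : Fin n → ℕ} {σ : List ℕ} (e : ℕ → ℕ)
    (he : ∀ a ∈ σ, ∀ b ∈ σ, e a < e b ↔ a < b) (h : (σ.map e).Sublist (List.ofFn π)) :
    Contains π σ := by
  rw [List.ofFn_eq_map, List.sublist_map_iff] at h
  obtain ⟨l, hl, hlσ⟩ := h
  have hlen : σ.length = l.length := by simpa using congrArg List.length hlσ
  have hmono : l.SortedLT := ((List.pairwise_lt_finRange n).sublist hl).sortedLT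
  have hval : ∀ i : Fin σ.length, π (l.get (i.cast hlen)) = e (σ.get i) := by
    intro i
    have := List.getElem_of_eq hlσ (i := i.1) (by simp)
    simpa using this.symm
  refine ⟨fun i => l.get (i.cast hlen), fun i j hij => hmono.strictMono_get hij, fun i j => ?_⟩
  rw [hval, hval]
  exact he _ (List.get_mem _ _) _ (List.get_mem _ _)

theorem sublist_of_contains {n : ℕ} {π : Fin n → ℕ} {σ : List ℕ} (h : Contains π σ)
    (k : Fin σ.length) :
    ∃ j, (levelWord (σ.get k) σ).Sublist (levelWord j (List.ofFn π)) := by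
  obtain ⟨f, hf, hfσ⟩ := h
  refine ⟨π (f k), ?_⟩
  have hcmp : levelWord (σ.get k) σ = levelWord (π (f k)) (List.ofFn (π ∘ f)) := by
    trans levelWord (σ.get k) (List.ofFn σ.get)
    · rw [List.ofFn_get]
    rw [levelWord, levelWord, List.map_ofFn, List.map_ofFn, List.ofFn_inj]
    funext i
    have h₁ := hfσ i k
    have h₂ := hfσ k i
    simp only [Function.comp]
    rcases lt_trichotomy (σ.get i) (σ.get k) with h | h | h
    · rw [compare_lt_iff_lt.2 h, compare_lt_iff_lt.2 (h₁.2 h)]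
    · rw [compare_eq_iff_eq.2 h, compare_eq_iff_eq.2]
      omega
    · rw [compare_gt_iff_gt.2 h, compare_gt_iff_gt.2 (h₂.2 h)]
  rw [hcmp]
  refine List.Sublist.map _ ?_
  rw [List.ofFn_eq_map (f := π), ← List.map_ofFn]
  refine List.Sublist.map _ (List.sublist_of_subperm_of_pairwise (r := (· < ·)) ?_ ?_
    (List.pairwise_lt_finRange n))
  · exact (List.nodup_ofFn.2 hf.injective).subperm fun i _ => List.mem_finRange i
  · exact List.pairwise_ofFn.2 fun i j hij => hf hij

/-- A restricted growth word cannot reach `j` without having passed through `l`. -/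
theorem RG.cons_sublist {k j l : ℕ} {x z : List ℕ} (hx : RG k x) (hk : k < l) (hl : l < j)
    (h : (j :: z).Sublist x) : (l :: j :: z).Sublist x := by
  induction x generalizing k with
  | nil => simp at h
  | cons a x ih =>
    obtain ⟨-, h₂, h₃⟩ := hx
    have h' : (j :: z).Sublist x := by
      rw [List.cons_sublist_cons'] at h
      rcases h with h | ⟨rfl, -⟩
      · exact h
      · omega
    rcases Nat.lt_or_ge a l with hal | hal
    · exact (ih h₃ (by omega) h').cons _
    · obtain rfl : a = l := by omega
      exact h'.cons_cons _

theorem map_compare_split {j p : ℕ} {o : Ordering} {z : List ℕ} {Y : List Ordering}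
    (h : z.map (fun a => compare a j) = List.replicate p .eq ++ o :: Y) :
    ∃ a z', compare a j = o ∧ z'.map (fun a => compare a j) = Y ∧
      z = List.replicate p j ++ a :: z' := by
  obtain ⟨u, v, rfl, hu, hv⟩ := List.map_eq_append_iff.1 h
  obtain ⟨a, z', rfl, ha, hz⟩ := List.map_eq_cons_iff.1 hv
  refine ⟨a, z', ha, hz, ?_⟩
  rw [List.eq_replicate_iff] at hu
  rw [(List.eq_replicate_iff (a := j) (l := u) (n := p)).2 ⟨by simpa using hu.1, fun b hb => ?_⟩]
  exact compare_eq_iff_eq.1 (hu.2 _ (List.mem_map_of_mem hb))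

/-- The word `1 2^(p+1) a 2^q b 2^r`. -/
def patternWord (a b p q r : ℕ) : List ℕ :=
  1 :: (List.replicate (p + 1) 2 ++ a :: (List.replicate q 2 ++ b :: List.replicate r 2))

theorem contains_patternWord_iff {n : ℕ} {π : Fin n → ℕ} (hπ : RG 0 (List.ofFn π)) {a b : ℕ}
    (hab : a = 1 ∧ b = 3 ∨ a = 3 ∧ b = 1) (p q r : ℕ) :
    Contains π (patternWord a b p q r) ↔
      ∃ j, (Ordering.eq :: triWord (compare a 2) (compare b 2) p q r).Sublist
        (levelWord j (List.ofFn π)) := by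
  constructor
  · intro h
    -- Position 1 holds the first `2`, whose image fixes the level.
    obtain ⟨j, hj⟩ := sublist_of_contains h ⟨1, by simp [patternWord]⟩
    refine ⟨j, List.Sublist.trans ?_ hj⟩
    have : (patternWord a b p q r).get ⟨1, by simp [patternWord]⟩ = 2 := by
      simp [patternWord, List.replicate_succ]
    rw [this]
    simp [patternWord, levelWord, triWord, List.replicate_succ]
  · rintro ⟨j, h⟩
    obtain ⟨z, hz, hzj⟩ := List.sublist_map_iff.1 h
    obtain ⟨s, z₁, hs, hz₁, rfl⟩ := map_compare_split (p := p + 1) hzj.symm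
    obtain ⟨t, z₂, ht, hz₂, rfl⟩ := map_compare_split hz₁
    have hr : z₂ = List.replicate r j := by
      rw [List.eq_replicate_iff] at hz₂ ⊢
      exact ⟨by simpa using hz₂.1,
        fun b hb => compare_eq_iff_eq.1 (hz₂.2 _ (List.mem_map_of_mem hb))⟩
    subst hr
    have hpos : ∀ x ∈ List.ofFn π, 1 ≤ x := by
      intro x hx
      obtain ⟨i, rfl⟩ := List.mem_ofFn.1 hx
      exact ((RG.ofFn_iff.1 hπ) i).1
    have hs₁ : 1 ≤ s := hpos s (hz.subset (by simp))
    have ht₁ : 1 ≤ t := hpos t (hz.subset (by simp))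
    rcases hab with ⟨rfl, rfl⟩ | ⟨rfl, rfl⟩
    · have hsj : s < j := compare_lt_iff_lt.1 hs
      have hjt : j < t := compare_gt_iff_gt.1 ht
      -- The lower letter `s` also provides the value for the leading `1`.
      refine contains_of_sublist (fun i => if i = 1 then s else if i = 2 then j else t) ?_ ?_
      · have : ∀ c ∈ patternWord 1 3 p q r, c = 1 ∨ c = 2 ∨ c = 3 := by
          simp [patternWord]; grind
        intro c hc d hd
        rcases this c hc with rfl | rfl | rfl <;> rcases this d hd with rfl | rfl | rfl <;>
          simp <;> omega
      · have := hπ.cons_sublist (l := s) (by omega) hsj hz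
        simpa [patternWord, List.replicate_succ] using this
    · have hsj : j < s := compare_gt_iff_gt.1 hs
      have hjt : t < j := compare_lt_iff_lt.1 ht
      refine contains_of_sublist (fun i => if i = 1 then t else if i = 2 then j else s) ?_ ?_
      · have : ∀ c ∈ patternWord 3 1 p q r, c = 1 ∨ c = 2 ∨ c = 3 := by
          simp [patternWord]; grind
        intro c hc d hd
        rcases this c hc with rfl | rfl | rfl <;> rcases this d hd with rfl | rfl | rfl <;>
          simp <;> omega
      · have := hπ.cons_sublist (l := t) (by omega) hjt hz
        simpa [patternWord, List.replicate_succ] using this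

theorem ncard_avoiders_patternWord (n : ℕ) {a b : ℕ} (hab : a = 1 ∧ b = 3 ∨ a = 3 ∧ b = 1)
    (p q r : ℕ) : (avoiders n (patternWord a b p q r)).ncard =
      (levelAvoiders n (triWord (compare a 2) (compare b 2) p q r)).ncard := by
  have hinj : Function.Injective fun P : Finpartition (Finset.univ : Finset (Fin n)) =>
      List.ofFn (canonicalSeq P) :=
    List.ofFn_injective.comp canonicalSeq_injective
  rw [← Set.ncard_image_of_injective _ hinj]
  congr 1
  ext x
  constructor
  · rintro ⟨P, hP, rfl⟩
    refine ⟨⟨RG_canonicalSeq, by simp⟩, fun j hj => hP ?_⟩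
    exact (contains_patternWord_iff RG_canonicalSeq hab p q r).2 ⟨j, hj⟩
  · rintro ⟨⟨hx, rfl⟩, h⟩
    obtain ⟨P, hP⟩ := exists_canonicalSeq_eq (c := x.get) (by rwa [List.ofFn_get])
    have hPx : List.ofFn (canonicalSeq P) = x := by rw [hP, List.ofFn_get]
    refine ⟨P, fun hc => ?_, hPx⟩
    obtain ⟨j, hj⟩ := (contains_patternWord_iff RG_canonicalSeq hab p q r).1 hc
    exact h j (hPx ▸ hj)

theorem patternEquiv_plusWord_minusWord {p q r p' q' r' : ℕ} (h : p + q + r = p' + q' + r') :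
    PatternEquiv (plusWord p q r) (minusWord p' q' r') := by
  intro n
  have h₁ := ncard_avoiders_patternWord n (.inl ⟨rfl, rfl⟩) p q r
  have h₂ := ncard_avoiders_patternWord n (.inr ⟨rfl, rfl⟩) p' q' r'
  rw [show patternWord 1 3 p q r = plusWord p q r by simp [patternWord, plusWord]] at h₁
  rw [show patternWord 3 1 p' q' r' = minusWord p' q' r' by simp [patternWord, minusWord]] at h₂
  rw [h₁, h₂]
  exact ncard_levelAvoiders n (triEquiv_triWord h) (reduced_triWord (by decide) (by decide) _ _ _)
    (reduced_triWord (by decide) (by decide) _ _ _) (separated_triWord (by decide) (by decide) _ _ _)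
    (separated_triWord (by decide) (by decide) _ _ _)

end SetPartition

theorem mainTheorem8 (t : ℕ) (σ τ : List ℕ) (hσ : σ ∈ SetPartition.sigmaSet t)
    (hτ : τ ∈ SetPartition.sigmaSet t) : SetPartition.PatternEquiv σ τ := by
  have key : ∀ ρ ∈ SetPartition.sigmaSet t, ∀ n,
      (SetPartition.avoiders n ρ).ncard =
        (SetPartition.avoiders n (SetPartition.plusWord t 0 0)).ncard := by
    rintro ρ (⟨p, q, r, h, rfl⟩ | ⟨p, q, r, h, rfl⟩) n
    -- Only words from opposite families are compared directly, so two plus words are linked through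
    -- a minus word.
    · rw [SetPartition.patternEquiv_plusWord_minusWord (p' := t) (q' := 0) (r' := 0) (by omega) n,
        SetPartition.patternEquiv_plusWord_minusWord (p := t) (q := 0) (r := 0) rfl n]
    · exact (SetPartition.patternEquiv_plusWord_minusWord (by omega) n).symm
  exact fun n => (key σ hσ n).trans (key τ hτ n).symm
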